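/- Let $p$ be an odd prime, let $m$ and $s$ be positive integers, and let $\mathcal{R}=\mathbb{F}_{p^m}[u,v]/\langle u^2,v^2,uv-vu\rangle$. Let $\alpha_1,\alpha_3\in\mathbb{F}_{p^m}\setminus\{0\}$ and $\alpha_4\in\mathbb{F}_{p^m}$ be such that $\alpha=\alpha_1+\alpha_3v+\alpha_4uv$ is not a square in $\mathcal{R}$. Let $r_0$ be the remainder of $s$ on division by $m$ and put $\alpha_0=\alpha_1^{p^{m-r_0}}$, so that $\alpha_0^{p^s}=\alpha_1$. For $0\le\ell\le 2p^s-1$ let $\mathcal{C}=\langle u(x^2-\alpha_0)^\ell\rangle$ be the ideal of $\mathcal{R}[x]/\langle x^{2p^s}-\alpha\rangle$ generated by $u(x^2-\alpha_0)^\ell$, regarded as a code of length $2p^s$ over $\mathcal{R}$ by identifying a word $(c_0,\dots,c_{2p^s-1})\in\mathcal{R}^{2p^s}$ with the class of $c_0+c_1x+\dots+c_{2p^s-1}x^{2p^s-1}$. Let $d_H(\mathcal{C})$ be its Hamming distance, that is, the minimum, over all pairs of distinct codewords, of the number of positions in which they differ. Then $$d_H(\mathcal{C})=\begin{cases}1 &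 \text{if } 0\le\ell\le p^s,\\ (\Gamma+1)p^{\gamma} & \text{if } 2p^s-p^{s-\gamma}+(\Gamma-1)p^{s-\gamma-1}+1\le\ell\le 2p^s-p^{s-\gamma}+\Gamma p^{s-\gamma-1},\end{cases}$$ where in the second case $\Gamma$ and $\gamma$ are any integers with $1\le\Gamma\le p-1$ and $0\le\gamma\le s-1$. -/

import Mathlib

/-- The ring `𝓡 = F[u, v] / ⟨u², v², uv - vu⟩`; the two variables `u`, `v` are `X 0`, `X 1`. -/
abbrev BaseRing (F : Type*) [Field F] : Type _ :=
  MvPolynomial (Fin 2) F ⧸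
    (Ideal.span {MvPolynomial.X 0 ^ 2, MvPolynomial.X 1 ^ 2,
      MvPolynomial.X 0 * MvPolynomial.X 1 - MvPolynomial.X 1 * MvPolynomial.X 0} :
      Ideal (MvPolynomial (Fin 2) F))

namespace BaseRing

/-- The class of the first variable in `𝓡`. -/
noncomputable def u (F : Type*) [Field F] : BaseRing F :=
  Ideal.Quotient.mk _ (MvPolynomial.X 0)

/-- The class of the second variable in `𝓡`. -/
noncomputable def v (F : Type*) [Field F] : BaseRing F :=
  Ideal.Quotient.mk _ (MvPolynomial.X 1)

/-- The inclusion of the scalars `F` in `𝓡`. -/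
noncomputable def scalar {F : Type*} [Field F] (a : F) : BaseRing F :=
  Ideal.Quotient.mk _ (MvPolynomial.C a)

end BaseRing

/-- The ambient ring `A[x] / ⟨x ^ n - α⟩` of the `α`-constacyclic codes of length `n` over `A`. -/
abbrev ConstacyclicRing {A : Type*} [CommRing A] (n : ℕ) (α : A) : Type _ :=
  AdjoinRoot (Polynomial.X ^ n - Polynomial.C α : Polynomial A)

/-- The class in `A[x] / ⟨x ^ n - α⟩` of `c₀ + c₁ x + ⋯ + cₙ₋₁ x ^ (n - 1)`, the polynomial
representation of the word `c = (c₀, …, cₙ₋₁)`. -/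
noncomputable def wordClass {A : Type*} [CommRing A] {n : ℕ} (α : A) (c : Fin n → A) :
    ConstacyclicRing n α :=
  AdjoinRoot.mk _ (∑ i : Fin n, Polynomial.C (c i) * Polynomial.X ^ (i : ℕ))

/-- The code in `A ^ n` that an ideal of `A[x] / ⟨x ^ n - α⟩` stands for: the set of the words
whose polynomial representation lies in the ideal. -/
def codeOfIdeal {A : Type*} [CommRing A] {n : ℕ} {α : A} (I : Ideal (ConstacyclicRing n α)) :
    Set (Fin n → A) :=
  {c | wordClass α c ∈ I}

open Classical in
/-- The Hamming distance of a code: the least number of places in which two different codewords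
differ (`0` for a code with fewer than two words). -/
noncomputable def codeHammingDistance {A : Type*} {n : ℕ} (C : Set (Fin n → A)) : ℕ :=
  sInf {d : ℕ | ∃ x ∈ C, ∃ y ∈ C, x ≠ y ∧ hammingDist x y = d}

/-- `α₀ = α₁ ^ (p ^ (m - r₀))`, where `r₀` is the remainder of `s` on division by `m`. -/
def alphaZero {F : Type*} [Field F] (p m s : ℕ) (α₁ : F) : F :=
  α₁ ^ p ^ (m - s % m)

/-- The code `⟨u (x² - α₀) ^ ℓ⟩` as an ideal of `𝓡[x] / ⟨x ^ n - α⟩`. -/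
noncomputable def typeBIdeal {F : Type*} [Field F] (n : ℕ) (α : BaseRing F) (α₀ : F) (ℓ : ℕ) :
    Ideal (ConstacyclicRing n α) :=
  Ideal.span {AdjoinRoot.mk _ (Polynomial.C (BaseRing.u F) *
    (Polynomial.X ^ 2 - Polynomial.C (BaseRing.scalar α₀)) ^ ℓ)}

/-! Write `N = p ^ s`. Since `(x² - α₀) ^ N = x ^ (2N) - α₁` over `F`, in the quotient ring `u (x² -
α₀) ^ N = u (α - α₁) = α₃ u v`, and `α₃` is a unit. Hence for `ℓ ≤ N` the constant word `u v` is a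
codeword and the distance is 1. For `ℓ = N + i` the code is `u v` times the multiples of `(x² - α₀)
^ i` in `F[x] / ⟨x ^ (2N) - α₁⟩`, because `u` and `v` kill `u v`. So the question concerns the
number of terms of polynomials over `F`.

Splitting exponents by parity replaces `x² - α₀` by `x - α₀` and `2N` by `N`. A nonzero polynomial
vanishing to order exactly `t` at a nonzero point has at least `∏ (d + 1)` terms, `d` running over
the base `p` digits of `t` (`digitProd_rootMultiplicity_le_card_support`). Minimizing this product
over `i ≤ t < N` gives the lower bound (`le_digitProd_of_lt`); a suitable power of `x² - α₀` attains
it (`card_support_X_sq_sub_C_pow_le`). -/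

/-! ### Products over base `p` digits. -/

/-- The product of the numbers `d + 1`, with `d` running over the base `p` digits of `t`. -/
def digitProd (p t : ℕ) : ℕ := ((Nat.digits p t).map (· + 1)).prod

theorem digitProd_zero (p : ℕ) : digitProd p 0 = 1 := by simp [digitProd]

theorem digitProd_eq_mul {p : ℕ} (hp : 1 < p) (t : ℕ) :
    digitProd p t = (t % p + 1) * digitProd p (t / p) := by
  rcases Nat.eq_zero_or_pos t with rfl | ht
  · simp [digitProd]
  · simp [digitProd, Nat.digits_def' hp ht]

theorem digitProd_add_mul {p : ℕ} (hp : 1 < p) {d : ℕ} (hd : d < p) (x : ℕ) :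
    digitProd p (p * x + d) = (d + 1) * digitProd p x := by
  have h1 : (p * x + d) % p = d := by rw [Nat.mul_add_mod, Nat.mod_eq_of_lt hd]
  have h2 : (p * x + d) / p = x := by
    rw [Nat.mul_add_div (by omega), Nat.div_eq_of_lt hd, add_zero]
  rw [digitProd_eq_mul hp, h1, h2]

theorem digitProd_pow_mul {p : ℕ} (hp : 1 < p) (k x : ℕ) :
    digitProd p (p ^ k * x) = digitProd p x := by
  induction k with
  | zero => simp
  | succ k ih =>
    have := digitProd_add_mul hp (d := 0) (by omega) (p ^ k * x)
    rw [pow_succ', mul_assoc, ← ih]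
    simpa using this

theorem digitProd_pow_sub_one {p : ℕ} (hp : 1 < p) (k : ℕ) :
    digitProd p (p ^ k - 1) = p ^ k := by
  induction k with
  | zero => simp [digitProd_zero]
  | succ k ih =>
    have h1 : 1 ≤ p ^ k := Nat.one_le_pow _ _ (by omega)
    obtain ⟨c, hc⟩ := Nat.exists_eq_add_of_le h1
    have h2 : p ^ (k + 1) - 1 = p * (p ^ k - 1) + (p - 1) := by
      rw [pow_succ', hc, mul_add]; simp; omega
    rw [h2, digitProd_add_mul hp (by omega), ih, pow_succ', Nat.sub_add_cancel (by omega)]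

/-- The excluded bound has, from the top, `γ` digits `p - 1`, one digit `Γ - 1`, then `k` zeros. A
larger `t` with no more digits either has the same top `γ` digits and a next digit at least `Γ`, or
agrees in the top `γ + 1` digits and has a nonzero digit below. The induction on `k` strips the last
digit. -/
theorem le_digitProd_of_lt {p : ℕ} (hp : 1 < p) {Γ : ℕ} (hΓ : 1 ≤ Γ) (hΓp : Γ ≤ p - 1) (γ k : ℕ) :
    ∀ t, p ^ k * (p * (p ^ γ - 1) + (Γ - 1)) < t → t < p ^ (γ + 1 + k) →
      (Γ + 1) * p ^ γ ≤ digitProd p t := by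
  have hγ : 1 ≤ p ^ γ := Nat.one_le_pow _ _ (by omega)
  induction k with
  | zero =>
    intro t h1 h2
    simp only [pow_zero, one_mul, add_zero] at h1 h2
    obtain ⟨d, rfl⟩ := Nat.exists_eq_add_of_le (show p * (p ^ γ - 1) ≤ t by omega)
    have hp2 : p * (p ^ γ - 1) + p = p ^ (γ + 1) := by
      rw [pow_succ', ← Nat.mul_succ, Nat.succ_eq_add_one, Nat.sub_add_cancel hγ]
    rw [digitProd_add_mul hp (by omega), digitProd_pow_sub_one hp]
    exact Nat.mul_le_mul_right _ (by omega)
  | succ k ih =>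
    intro t h1 h2
    set M := p * (p ^ γ - 1) + (Γ - 1) with hM
    have hlt : t / p < p ^ (γ + 1 + k) := by
      rw [Nat.div_lt_iff_lt_mul (by omega)]
      rwa [← add_assoc, pow_succ] at h2
    have hle : p ^ k * M ≤ t / p := by
      rw [Nat.le_div_iff_mul_le (by omega)]
      rw [pow_succ] at h1
      linarith [mul_right_comm (p ^ k) M p]
    rw [digitProd_eq_mul hp]
    rcases hle.lt_or_eq with h | h
    · exact (ih _ h hlt).trans (Nat.le_mul_of_pos_left _ (by omega))
    -- Boundary case: the last digit is nonzero, so it contributes a factor of at least 2, and `2 *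
    -- Γ ≥ Γ + 1`.
    · have hmod : 1 ≤ t % p := by
        by_contra h0
        have := Nat.div_add_mod t p
        rw [← h, show t % p = 0 by omega] at this
        rw [pow_succ] at h1
        linarith [mul_right_comm (p ^ k) M p, mul_comm p (p ^ k * M)]
      rw [← h, digitProd_pow_mul hp, hM, digitProd_add_mul hp (by omega),
        digitProd_pow_sub_one hp, Nat.sub_add_cancel hΓ, ← mul_assoc]
      exact Nat.mul_le_mul_right _ (by nlinarith)

/-! ### Splitting a polynomial by residue classes of exponents. -/

open Polynomial in
/-- The polynomial whose `k`-th coefficient is the coefficient of `f` at `n * k + j`. -/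
noncomputable def Polynomial.residueSection {R : Type*} [Semiring R] (n j : ℕ) (f : R[X]) : R[X] :=
  ∑ k ∈ Finset.range (f.natDegree + 1), monomial k (f.coeff (n * k + j))

namespace Polynomial

section residueSection

variable {R : Type*} [CommSemiring R] {n : ℕ} (j : ℕ)

theorem coeff_residueSection (hn : 0 < n) (f : R[X]) (k : ℕ) :
    (residueSection n j f).coeff k = f.coeff (n * k + j) := by
  simp only [residueSection, finsetSum_coeff, coeff_monomial]
  rw [Finset.sum_ite_eq' (Finset.range (f.natDegree + 1)) k]
  split_ifs with h
  · rfl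
  · symm
    apply coeff_eq_zero_of_natDegree_lt
    have : k ≤ n * k := Nat.le_mul_of_pos_left _ hn
    simp at h
    omega

theorem residueSection_add (hn : 0 < n) (f g : R[X]) :
    residueSection n j (f + g) = residueSection n j f + residueSection n j g := by
  ext k
  simp [coeff_residueSection j hn]

/-- Multiplying by a polynomial in `X ^ n` preserves exponents modulo `n`, so taking a section is
linear over such polynomials. -/
theorem residueSection_expand_mul (hn : 0 < n) (hj : j < n) (q f : R[X]) :
    residueSection n j (expand R n q * f) = q * residueSection n j f := by
  induction q using Polynomial.induction_on' with
  | add q r hq hr => rw [map_add, add_mul, residueSection_add j hn, hq, hr, add_mul]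
  | monomial m c =>
    ext k
    rw [coeff_residueSection j hn, expand_monomial, ← C_mul_X_pow_eq_monomial,
      ← C_mul_X_pow_eq_monomial, mul_assoc, mul_assoc, coeff_C_mul, coeff_C_mul, coeff_X_pow_mul',
      coeff_X_pow_mul', coeff_residueSection j hn]
    congr 1
    by_cases h : m ≤ k
    · obtain ⟨k, rfl⟩ := Nat.exists_eq_add_of_le h
      have h1 : n * (m + k) + j = m * n + (n * k + j) := by ring
      rw [if_pos h, h1, if_pos (Nat.le_add_right _ _), Nat.add_sub_cancel_left,
        Nat.add_sub_cancel_left]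
    · rw [if_neg h, if_neg]
      have : n * (k + 1) ≤ n * m := Nat.mul_le_mul_left _ (by omega)
      rw [mul_add, mul_one] at this
      rw [mul_comm m n]
      omega

theorem sum_X_pow_mul_expand_residueSection (hn : 0 < n) (f : R[X]) :
    f = ∑ j ∈ Finset.range n, X ^ j * expand R n (residueSection n j f) := by
  ext i
  rw [finsetSum_coeff, Finset.sum_eq_single (i % n)]
  · rw [coeff_X_pow_mul', if_pos (Nat.mod_le _ _), coeff_expand hn, if_pos (Nat.dvd_sub_mod i),
      coeff_residueSection _ hn]
    congr 1
    have : i - i % n = n * (i / n) := by have := Nat.div_add_mod i n; omega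
    rw [this, Nat.mul_div_cancel_left _ hn]
    exact (Nat.div_add_mod i n).symm
  · intro b hb hne
    rw [coeff_X_pow_mul']
    split_ifs with h
    · rw [coeff_expand hn, if_neg]
      intro hd
      apply hne
      obtain ⟨c, hc⟩ := hd
      have : i = b + n * c := by omega
      rw [this, Nat.add_mul_mod_self_left, Nat.mod_eq_of_lt (Finset.mem_range.mp hb)]
    · rfl
  · intro h
    exact absurd (Finset.mem_range.mpr (Nat.mod_lt _ hn)) h

theorem sum_card_support_residueSection_le (hn : 0 < n) (f : R[X]) :
    ∑ j ∈ Finset.range n, (residueSection n j f).support.card ≤ f.support.card := by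
  rw [Finset.card_eq_sum_card_fiberwise (f := fun i => i % n) (t := Finset.range n)
    (fun i _ => by simpa using Nat.mod_lt i hn)]
  refine Finset.sum_le_sum fun j hj => Finset.card_le_card_of_injOn (fun k => n * k + j) ?_ ?_
  · intro k hk
    have hk' : (residueSection n j f).coeff k ≠ 0 := by simpa using hk
    rw [coeff_residueSection j hn] at hk'
    simpa [Nat.mul_add_mod, Nat.mod_eq_of_lt (Finset.mem_range.mp hj)] using hk'
  · intro k _ l _ h
    exact Nat.eq_of_mul_eq_mul_left hn (Nat.add_right_cancel h)

end residueSection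

/-! ### Number of terms versus order of vanishing over a field of characteristic `p`. -/

section weight

variable {F : Type*} [Field F]

/-- The operator `X d/dX - k` kills the term of exponent `k` and lowers the order of vanishing at
`a` by at most one. Exponents below `p` are distinct in `F`, so no other term is lost. -/
theorem lt_card_support_of_pow_dvd {p : ℕ} [CharP F p] {a : F} (ha : a ≠ 0) (t : ℕ) :
    ∀ h : F[X], h ≠ 0 → (∀ j ∈ h.support, j < p) → (X - C a) ^ t ∣ h → t < h.support.card := by
  induction t with
  | zero =>
    intro h h0 _ _
    exact Finset.card_pos.mpr (support_nonempty.mpr h0)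
  | succ t ih =>
    intro h h0 hp hd
    obtain ⟨k, hk⟩ := support_nonempty.mpr h0
    set g : F[X] := X * derivative h - C (k : F) * h with hg
    have hcoeff (j : ℕ) : g.coeff j = ((j : F) - k) * h.coeff j := by
      cases j with
      | zero => simp [hg]
      | succ j => simp [hg, coeff_X_mul, coeff_derivative]; ring
    have hsub : g.support ⊆ h.support.erase k := by
      intro j hj
      rw [mem_support_iff, hcoeff] at hj
      rw [Finset.mem_erase, mem_support_iff]
      refine ⟨?_, right_ne_zero_of_mul hj⟩
      rintro rfl
      simp at hj
    have hdvd : (X - C a) ^ t ∣ g :=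
      dvd_sub (Dvd.dvd.mul_left (by simpa using pow_sub_one_dvd_derivative_of_pow_dvd hd) _)
        (Dvd.dvd.mul_left ((pow_dvd_pow _ (Nat.le_succ t)).trans hd) _)
    -- If `g = 0` then `h` is a single monomial, which cannot vanish at `a ≠ 0`.
    have hg0 : g ≠ 0 := by
      intro hg0
      have hroot : h.eval a = 0 := by
        rw [← IsRoot, ← dvd_iff_isRoot]
        exact (dvd_pow_self _ (Nat.succ_ne_zero t)).trans hd
      have hmon : h = monomial k (h.coeff k) := by
        ext j
        rw [coeff_monomial]
        split_ifs with hjk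
        · rw [hjk]
        · by_contra hj
          have h1 := hcoeff j
          rw [hg0, coeff_zero] at h1
          have h2 : (j : F) = k := sub_eq_zero.mp ((mul_eq_zero.mp h1.symm).resolve_right hj)
          exact hjk (CharP.natCast_injOn_Iio F p (hp k hk) (hp j (mem_support_iff.mpr hj)) h2.symm)
      rw [hmon, eval_monomial] at hroot
      exact mul_ne_zero (mem_support_iff.mp hk) (pow_ne_zero _ ha) hroot
    have h1 := ih g hg0 (fun j hj => hp j (Finset.mem_of_mem_erase (hsub hj))) hdvd
    have h2 := Finset.card_le_card hsub
    rw [Finset.card_erase_of_mem hk] at h2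
    omega

theorem X_pow_sub_C_dvd_expand_sub_C (n : ℕ) (b : F) (q : F[X]) :
    X ^ n - C b ∣ expand F n q - C (q.eval b) := by
  obtain ⟨r, hr⟩ : X - C b ∣ q - C (q.eval b) := X_sub_C_dvd_sub_C_eval
  refine ⟨expand F n r, ?_⟩
  simpa using congrArg (expand F n) hr

/-- Since `(X - a) ^ p = X ^ p - a ^ p`, the factor `(X - a) ^ (p * (t / p))` is a polynomial in `X
^ p` and passes to every section modulo `p`. The last digit bounds below how many sections vanish to
order exactly `t / p` at `a ^ p`; induction bounds the terms of each. -/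
theorem digitProd_rootMultiplicity_le_card_support {p : ℕ} [hp : Fact p.Prime] [CharP F p] (t : ℕ) :
    ∀ (a : F), a ≠ 0 → ∀ g : F[X], g ≠ 0 → g.rootMultiplicity a = t →
      digitProd p t ≤ g.support.card := by
  induction t using Nat.strong_induction_on with
  | _ t ih =>
  intro a ha g hg ht
  rcases Nat.eq_zero_or_pos t with rfl | htpos
  · rw [digitProd_zero]
    exact Finset.card_pos.mpr (support_nonempty.mpr hg)
  have hp0 : 0 < p := hp.out.pos
  obtain ⟨h, hgh, hh⟩ := exists_eq_pow_rootMultiplicity_mul_and_not_dvd g hg a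
  rw [ht] at hgh
  set h' : F[X] := (X - C a) ^ (t % p) * h with hh'
  have hXp : (X - C a : F[X]) ^ p = X ^ p - C (a ^ p) := by
    rw [sub_pow_char, C_pow]
  have hg' : g = expand F p ((X - C (a ^ p)) ^ (t / p)) * h' := by
    rw [map_pow, map_sub, expand_X, expand_C, ← hXp, ← pow_mul, hh', ← mul_assoc, ← pow_add,
      Nat.div_add_mod, ← hgh]
  -- The remainder of `h'` modulo `X ^ p - a ^ p`: setting `X ^ p = a ^ p` turns each section into
  -- its value at `a ^ p`.
  set r : F[X] := ∑ j ∈ Finset.range p, monomial j ((residueSection p j h').eval (a ^ p)) with hr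
  have hrcoeff (j : ℕ) (hj : r.coeff j ≠ 0) :
      j < p ∧ (residueSection p j h').eval (a ^ p) ≠ 0 := by
    simp only [hr, finsetSum_coeff, coeff_monomial] at hj
    rw [Finset.sum_ite_eq' (Finset.range p) j] at hj
    split_ifs at hj with hjp
    · exact ⟨Finset.mem_range.mp hjp, hj⟩
    · exact absurd rfl hj
  have hdr : (X - C a) ^ p ∣ h' - r := by
    rw [hXp]
    nth_rewrite 1 [sum_X_pow_mul_expand_residueSection hp0 h']
    rw [hr, ← Finset.sum_sub_distrib]
    refine Finset.dvd_sum fun j _ => ?_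
    rw [← C_mul_X_pow_eq_monomial, mul_comm (C _), ← mul_sub]
    exact (X_pow_sub_C_dvd_expand_sub_C _ _ _).mul_left _
  have hmod : t % p < p := Nat.mod_lt _ hp0
  have hr0 : r ≠ 0 := by
    intro hr0
    rw [hr0, sub_zero] at hdr
    have h1 := (pow_dvd_pow (X - C a) (show t % p + 1 ≤ p from hmod)).trans hdr
    rw [hh', pow_succ] at h1
    exact hh ((mul_dvd_mul_iff_left (pow_ne_zero _ (X_sub_C_ne_zero a))).mp h1)
  have hrdvd : (X - C a) ^ (t % p) ∣ r :=
    (dvd_sub_right (Dvd.intro _ rfl)).mp ((pow_dvd_pow (X - C a) hmod.le).trans hdr)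
  have hcard : t % p < r.support.card :=
    lt_card_support_of_pow_dvd ha _ r hr0 (fun j hj => (hrcoeff j (mem_support_iff.mp hj)).1) hrdvd
  have hsec : ∀ j ∈ r.support, digitProd p (t / p) ≤ (residueSection p j g).support.card := by
    intro j hj
    obtain ⟨hjp, hj⟩ := hrcoeff j (mem_support_iff.mp hj)
    have hs0 : residueSection p j h' ≠ 0 := by
      rintro h0
      simp [h0] at hj
    have hne : (X - C (a ^ p)) ^ (t / p) * residueSection p j h' ≠ 0 :=
      mul_ne_zero (pow_ne_zero _ (X_sub_C_ne_zero _)) hs0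
    have hsg : residueSection p j g = (X - C (a ^ p)) ^ (t / p) * residueSection p j h' := by
      rw [hg', residueSection_expand_mul j hp0 hjp]
    refine ih (t / p) (Nat.div_lt_self htpos hp.out.one_lt) (a ^ p) (pow_ne_zero _ ha) _ ?_ ?_
    · rwa [hsg]
    · rw [hsg, rootMultiplicity_mul hne, rootMultiplicity_X_sub_C_pow,
        rootMultiplicity_eq_zero hj, add_zero]
  calc digitProd p t = (t % p + 1) * digitProd p (t / p) := digitProd_eq_mul hp.out.one_lt t
    _ ≤ r.support.card * digitProd p (t / p) := Nat.mul_le_mul_right _ hcard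
    _ = ∑ _j ∈ r.support, digitProd p (t / p) := by simp
    _ ≤ ∑ j ∈ r.support, (residueSection p j g).support.card := Finset.sum_le_sum hsec
    _ ≤ ∑ j ∈ Finset.range p, (residueSection p j g).support.card := by
        refine Finset.sum_le_sum_of_subset fun j hj => Finset.mem_range.mpr ?_
        exact (hrcoeff j (mem_support_iff.mp hj)).1
    _ ≤ g.support.card := sum_card_support_residueSection_le hp0 g

theorem card_support_expand_le {R : Type*} [CommSemiring R] {n : ℕ} (hn : 0 < n) (f : R[X]) :
    (expand R n f).support.card ≤ f.support.card := by
  refine le_trans (Finset.card_le_card ?_) (Finset.card_image_le (s := f.support) (f := (· * n)))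
  intro i hi
  rw [mem_support_iff, coeff_expand hn] at hi
  split_ifs at hi with h
  · exact Finset.mem_image.mpr ⟨i / n, mem_support_iff.mpr hi, Nat.div_mul_cancel h⟩
  · exact absurd rfl hi

theorem card_support_X_sub_C_pow_le {p : ℕ} [hp : Fact p.Prime] [CharP F p] (a : F) (k e : ℕ) :
    ((X - C a) ^ (p ^ k * e)).support.card ≤ e + 1 := by
  have h : (X - C a : F[X]) ^ (p ^ k * e) = expand F (p ^ k) ((X - C (a ^ p ^ k)) ^ e) := by
    rw [pow_mul, sub_pow_char_pow, map_pow, map_sub, expand_X, expand_C, C_pow]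
  rw [h]
  refine (card_support_expand_le (pow_pos hp.out.pos k) _).trans ?_
  refine (card_supp_le_succ_natDegree _).trans ?_
  rw [natDegree_pow, natDegree_X_sub_C, mul_one]

/-- A nonzero multiple of `(X² - a) ^ i` of degree less than `2 p ^ s` has at least
`(Γ + 1) p ^ γ` nonzero coefficients, for `i` in the range belonging to `Γ` and `γ`. -/
theorem le_card_support_of_X_sq_sub_C_pow_dvd {p : ℕ} [hp : Fact p.Prime] [CharP F p] {a : F}
    (ha : a ≠ 0) {Γ γ k i : ℕ} (hΓ : 1 ≤ Γ) (hΓp : Γ ≤ p - 1)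
    (hi : p ^ k * (p * (p ^ γ - 1) + (Γ - 1)) < i) {f : F[X]} (hf : f ≠ 0)
    (hdeg : f.natDegree < 2 * p ^ (γ + 1 + k)) (hd : (X ^ 2 - C a) ^ i ∣ f) :
    (Γ + 1) * p ^ γ ≤ f.support.card := by
  obtain ⟨q, hq⟩ := hd
  have hq' : f = expand F 2 ((X - C a) ^ i) * q := by simpa using hq
  obtain ⟨j, hj, hj0⟩ : ∃ j < 2, residueSection 2 j f ≠ 0 := by
    by_contra! h
    apply hf
    rw [sum_X_pow_mul_expand_residueSection two_pos f]
    exact Finset.sum_eq_zero fun j hj => by rw [h j (Finset.mem_range.mp hj), map_zero, mul_zero]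
  set g := residueSection 2 j f with hg
  have hdg : (X - C a) ^ i ∣ g := by
    rw [hg, hq', residueSection_expand_mul j two_pos hj]
    exact Dvd.intro _ rfl
  -- The degree bound caps the multiplicity at `a`, so that it has at most `γ + 1 + k` digits.
  have hdegg : g.natDegree < p ^ (γ + 1 + k) := by
    have hc : f.coeff (2 * g.natDegree + j) ≠ 0 := by
      rw [← coeff_residueSection j two_pos]
      exact leadingCoeff_ne_zero.mpr hj0
    have := le_natDegree_of_ne_zero hc
    omega
  have hmult : i ≤ g.rootMultiplicity a := (le_rootMultiplicity_iff hj0).mpr hdg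
  have hmult' : g.rootMultiplicity a < p ^ (γ + 1 + k) :=
    lt_of_le_of_lt (by simpa using natDegree_le_of_dvd (pow_rootMultiplicity_dvd g a) hj0) hdegg
  calc (Γ + 1) * p ^ γ ≤ digitProd p (g.rootMultiplicity a) :=
        le_digitProd_of_lt hp.out.one_lt hΓ hΓp γ k _ (hi.trans_le hmult) hmult'
    _ ≤ g.support.card := digitProd_rootMultiplicity_le_card_support _ a ha g hj0 rfl
    _ ≤ ∑ j ∈ Finset.range 2, (residueSection 2 j f).support.card :=
        Finset.single_le_sum (f := fun j => (residueSection 2 j f).support.card)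
          (fun _ _ => Nat.zero_le _) (Finset.mem_range.mpr hj)
    _ ≤ f.support.card := sum_card_support_residueSection_le two_pos f

/-- After the substitution `X² ↦ X`, the power splits as `(X - a) ^ (p ^ k * Γ)` times `(X - a) ^ (p
^ (k + 1) * (p ^ γ - 1))`; by Frobenius these have at most `Γ + 1` and `p ^ γ` terms. -/
theorem card_support_X_sq_sub_C_pow_le {p : ℕ} [hp : Fact p.Prime] [CharP F p] (a : F)
    (Γ γ k : ℕ) :
    ((X ^ 2 - C a) ^ (p ^ k * (p * (p ^ γ - 1) + Γ))).support.card ≤ (Γ + 1) * p ^ γ := by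
  have h : (X ^ 2 - C a : F[X]) ^ (p ^ k * (p * (p ^ γ - 1) + Γ)) =
      expand F 2 ((X - C a) ^ (p ^ k * Γ) * (X - C a) ^ (p ^ (k + 1) * (p ^ γ - 1))) := by
    rw [← pow_add, map_pow, map_sub, expand_X, expand_C]
    congr 1
    ring
  rw [h]
  refine (card_support_expand_le two_pos _).trans (card_support_mul_le.trans ?_)
  have h2 := card_support_X_sub_C_pow_le (p := p) a (k + 1) (p ^ γ - 1)
  rw [Nat.sub_add_cancel (Nat.one_le_pow _ _ hp.out.pos)] at h2
  exact Nat.mul_le_mul (card_support_X_sub_C_pow_le a k Γ) h2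

end weight

end Polynomial

/-! ### The ideal generated by `u v` in the base ring. -/

namespace BaseRing

variable (F : Type*) [Field F]

/-- The inclusion of the scalars as a ring homomorphism. -/
noncomputable def scalarHom : F →+* BaseRing F :=
  (Ideal.Quotient.mk _).comp MvPolynomial.C

theorem u_mul_u : u F * u F = 0 := by
  rw [u, ← map_mul, ← pow_two]
  exact Ideal.Quotient.eq_zero_iff_mem.mpr (Ideal.subset_span (by simp))

theorem v_mul_v : v F * v F = 0 := by
  rw [v, ← map_mul, ← pow_two]
  exact Ideal.Quotient.eq_zero_iff_mem.mpr (Ideal.subset_span (by simp))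

/-- Dual numbers over dual numbers are a model of the relations in which the product of the two
infinitesimals is visibly nonzero. -/
theorem u_mul_v_ne_zero : u F * v F ≠ 0 := by
  let g : Fin 2 → DualNumber (DualNumber F) :=
    ![TrivSqZeroExt.inl DualNumber.eps, DualNumber.eps]
  let φ : MvPolynomial (Fin 2) F →+* DualNumber (DualNumber F) :=
    MvPolynomial.eval₂Hom (algebraMap F (DualNumber (DualNumber F))) g
  have h0 : φ (MvPolynomial.X 0) = TrivSqZeroExt.inl DualNumber.eps := by simp [φ, g]
  have h1 : φ (MvPolynomial.X 1) = DualNumber.eps := by simp [φ, g]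
  intro h
  rw [u, v, ← map_mul, Ideal.Quotient.eq_zero_iff_mem] at h
  have hle : Ideal.span {MvPolynomial.X 0 ^ 2, MvPolynomial.X 1 ^ 2,
      MvPolynomial.X 0 * MvPolynomial.X 1 - MvPolynomial.X 1 * MvPolynomial.X 0} ≤
      RingHom.ker φ := by
    rw [Ideal.span_le]
    rintro x (rfl | rfl | rfl)
    · simp [RingHom.mem_ker, h0, pow_two, ← TrivSqZeroExt.inl_mul]
    · simp [RingHom.mem_ker, h1, pow_two]
    · simp [mul_comm]
  have hk := hle h
  rw [RingHom.mem_ker, map_mul, h0, h1] at hk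
  have := congrArg (fun z => TrivSqZeroExt.snd (TrivSqZeroExt.snd z)) hk
  simp at this

variable {F}

theorem u_mul_v_mul_scalarHom_ne_zero {a : F} (ha : a ≠ 0) :
    u F * v F * scalarHom F a ≠ 0 := by
  intro h
  apply u_mul_v_ne_zero F
  have := congrArg (· * scalarHom F a⁻¹) h
  simpa [mul_assoc, ← map_mul, ha] using this

theorem exists_u_mul_v_mul_eq (r : BaseRing F) :
    ∃ a : F, u F * v F * r = u F * v F * scalarHom F a := by
  obtain ⟨q, rfl⟩ := Ideal.Quotient.mk_surjective r
  induction q using MvPolynomial.induction_on with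
  | C a => exact ⟨a, rfl⟩
  | add q r hq hr =>
    obtain ⟨a, ha⟩ := hq
    obtain ⟨b, hb⟩ := hr
    exact ⟨a + b, by rw [map_add, mul_add, ha, hb, map_add, mul_add]⟩
  | mul_X q i _ =>
    refine ⟨0, ?_⟩
    rw [map_zero, mul_zero, map_mul]
    fin_cases i
    · change u F * v F * (_ * u F) = 0
      linear_combination (v F * (Ideal.Quotient.mk _ q)) * u_mul_u F
    · change u F * v F * (_ * v F) = 0
      linear_combination (u F * (Ideal.Quotient.mk _ q)) * v_mul_v F

open Polynomial in
theorem exists_C_u_mul_v_mul_eq (q : (BaseRing F)[X]) :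
    ∃ f : F[X], C (u F * v F) * q = C (u F * v F) * f.map (scalarHom F) := by
  induction q using Polynomial.induction_on' with
  | add q r hq hr =>
    obtain ⟨a, ha⟩ := hq
    obtain ⟨b, hb⟩ := hr
    exact ⟨a + b, by rw [mul_add, ha, hb, Polynomial.map_add, mul_add]⟩
  | monomial n c =>
    obtain ⟨a, ha⟩ := exists_u_mul_v_mul_eq c
    exact ⟨monomial n a, by rw [map_monomial, C_mul_monomial, C_mul_monomial, ha]⟩

end BaseRing

/-! ### Distance as minimum weight, and words as polynomials. -/

section hamming

variable {A : Type*} [AddCommGroup A] {n : ℕ}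

open Classical in
theorem codeHammingDistance_eq {C : Set (Fin n → A)} (h0 : 0 ∈ C)
    (hsub : ∀ x ∈ C, ∀ y ∈ C, x - y ∈ C) {d : ℕ}
    (hle : ∀ c ∈ C, c ≠ 0 → d ≤ hammingNorm c) {c : Fin n → A} (hc : c ∈ C) (hc0 : c ≠ 0)
    (hcd : hammingNorm c ≤ d) : codeHammingDistance C = d := by
  have hmem : hammingDist c 0 ∈ {d : ℕ | ∃ x ∈ C, ∃ y ∈ C, x ≠ y ∧ hammingDist x y = d} :=
    ⟨c, hc, 0, h0, hc0, rfl⟩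
  unfold codeHammingDistance
  apply le_antisymm
  · refine (Nat.sInf_le hmem).trans ?_
    rwa [hammingDist_zero_right]
  · refine le_csInf ⟨_, hmem⟩ ?_
    rintro _ ⟨x, hx, y, hy, hxy, rfl⟩
    rw [hammingDist_eq_hammingNorm, neg_add_eq_sub]
    exact hle _ (hsub y hy x hx) (sub_ne_zero.mpr hxy.symm)

end hamming

section code

open Polynomial

variable {A : Type*} [CommRing A] {n : ℕ} {α : A}

theorem wordClass_sub (x y : Fin n → A) :
    wordClass α (x - y) = wordClass α x - wordClass α y := by
  simp [wordClass, sub_mul, Finset.sum_sub_distrib]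

theorem wordClass_zero : wordClass α (0 : Fin n → A) = 0 := by
  simp [wordClass]

theorem sum_C_mul_X_pow_eq {f : A[X]} (hf : f.natDegree < n) :
    ∑ i : Fin n, C (f.coeff i) * X ^ (i : ℕ) = f := by
  rw [Fin.sum_univ_eq_sum_range (fun i => C (f.coeff i) * X ^ i) n]
  exact (as_sum_range_C_mul_X_pow' f hf).symm

end code

/-! ### Reduction of the code to polynomials over the field. -/

section typeB

open Polynomial BaseRing

variable {F : Type*} [Field F]

theorem u_mul_constacyclicConstant {α₁ α₃ α₄ : F} {α : BaseRing F}
    (hα : α = scalar α₁ + scalar α₃ * v F + scalar α₄ * (u F * v F)) :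
    u F * α = u F * scalarHom F α₁ + u F * v F * scalarHom F α₃ := by
  rw [hα]
  change u F * (scalarHom F α₁ + scalarHom F α₃ * v F + scalarHom F α₄ * (u F * v F)) = _
  linear_combination (scalarHom F α₄ * v F) * u_mul_u F

theorem u_mul_v_mul_constacyclicConstant {α₁ α₃ α₄ : F} {α : BaseRing F}
    (hα : α = scalar α₁ + scalar α₃ * v F + scalar α₄ * (u F * v F)) :
    u F * v F * α = u F * v F * scalarHom F α₁ := by
  linear_combination v F * u_mul_constacyclicConstant hα +
    (scalarHom F α₃ * u F) * v_mul_v F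

variable {α₁ α₃ α₄ a : F} {α : BaseRing F} {N : ℕ}

/-- The key identity: modulo `X ^ (2 * N) - α` it reads `u (X² - a) ^ N = α₃ u v`, the part `α₄ u v`
of `α` being killed by `u`. -/
theorem C_u_mul_X_sq_sub_C_pow
    (hα : α = scalar α₁ + scalar α₃ * v F + scalar α₄ * (u F * v F))
    (hX : (X ^ 2 - C a : F[X]) ^ N = X ^ (2 * N) - C α₁) :
    C (u F) * (X ^ 2 - C (scalarHom F a)) ^ N =
      C (u F) * (X ^ (2 * N) - C α) + C (u F * v F) * C (scalarHom F α₃) := by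
  have h := congrArg (Polynomial.map (scalarHom F)) hX
  simp only [Polynomial.map_pow, Polynomial.map_sub, map_X, map_C] at h
  have h2 := congrArg C (u_mul_constacyclicConstant hα)
  simp only [C_mul, C_add] at h2 ⊢
  linear_combination C (u F) * h + h2

theorem C_u_mul_v_mul_X_pow_sub_C
    (hα : α = scalar α₁ + scalar α₃ * v F + scalar α₄ * (u F * v F)) (n : ℕ) :
    C (u F * v F) * (X ^ n - C α₁ : F[X]).map (scalarHom F) =
      C (u F * v F) * (X ^ n - C α) := by
  have h := congrArg C (u_mul_v_mul_constacyclicConstant hα)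
  simp only [Polynomial.map_pow, Polynomial.map_sub, map_X, map_C]
  simp only [C_mul] at h ⊢
  linear_combination h

theorem zero_mem_codeOfIdeal {n : ℕ} (I : Ideal (ConstacyclicRing n α)) : 0 ∈ codeOfIdeal I := by
  change wordClass α 0 ∈ I
  rw [wordClass_zero]
  exact I.zero_mem

theorem sub_mem_codeOfIdeal {n : ℕ} (I : Ideal (ConstacyclicRing n α)) :
    ∀ x ∈ codeOfIdeal I, ∀ y ∈ codeOfIdeal I, x - y ∈ codeOfIdeal I := by
  intro x hx y hy
  change wordClass α (x - y) ∈ I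
  rw [wordClass_sub]
  exact I.sub_mem hx hy

/-- The words `u v f` with `f` over the field and divisible by `(x² - a) ^ (ℓ - N)`
are codewords. -/
theorem u_mul_v_mul_coeff_mem_codeOfIdeal (hα₃ : α₃ ≠ 0)
    (hα : α = scalar α₁ + scalar α₃ * v F + scalar α₄ * (u F * v F))
    (hX : (X ^ 2 - C a : F[X]) ^ N = X ^ (2 * N) - C α₁) {ℓ : ℕ} {f : F[X]}
    (hf : f.natDegree < 2 * N) (hd : (X ^ 2 - C a) ^ (ℓ - N) ∣ f) :
    (fun i : Fin (2 * N) => u F * v F * scalarHom F (f.coeff i)) ∈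
      codeOfIdeal (typeBIdeal (2 * N) α a ℓ) := by
  have hword : ∑ i : Fin (2 * N), C (u F * v F * scalarHom F (f.coeff i)) * X ^ (i : ℕ) =
      C (u F * v F) * f.map (scalarHom F) := by
    conv_rhs => rw [← sum_C_mul_X_pow_eq hf]
    simp [Polynomial.map_sum, Finset.mul_sum, mul_assoc]
  change AdjoinRoot.mk _ _ ∈ Ideal.span {_}
  rw [hword, Ideal.mem_span_singleton]
  obtain ⟨g, rfl⟩ := hd
  set B : (BaseRing F)[X] := X ^ 2 - C (scalarHom F a) with hB
  have hinv : C (scalarHom F α₃) * C (scalarHom F α₃⁻¹) = 1 := by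
    rw [← C_mul, ← map_mul, mul_inv_cancel₀ hα₃, map_one, C_1]
  -- The last exponent is a truncated subtraction: `N - ℓ` if `ℓ ≤ N` and `0` otherwise, which
  -- treats both ranges of `ℓ` at once.
  have hpow : B ^ N * B ^ (ℓ - N) = B ^ ℓ * B ^ (N + (ℓ - N) - ℓ) := by
    rw [← pow_add, ← pow_add]
    congr 1
    omega
  have hmap : ((X ^ 2 - C a) ^ (ℓ - N) * g).map (scalarHom F) =
      B ^ (ℓ - N) * g.map (scalarHom F) := by
    simp [hB]
  have hkey := C_u_mul_X_sq_sub_C_pow hα hX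
  rw [← hB] at hkey
  have heq : C (u F * v F) * ((X ^ 2 - C a) ^ (ℓ - N) * g).map (scalarHom F) =
      (C (u F) * B ^ ℓ) * (B ^ (N + (ℓ - N) - ℓ) * C (scalarHom F α₃⁻¹) * g.map (scalarHom F)) -
      (X ^ (2 * N) - C α) *
        (C (u F) * C (scalarHom F α₃⁻¹) * (B ^ (ℓ - N) * g.map (scalarHom F))) := by
    rw [hmap]
    linear_combination (-C (u F * v F) * B ^ (ℓ - N) * g.map (scalarHom F)) * hinv -
      (C (scalarHom F α₃⁻¹) * B ^ (ℓ - N) * g.map (scalarHom F)) * hkey +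
      (C (u F) * C (scalarHom F α₃⁻¹) * g.map (scalarHom F)) * hpow
  rw [heq, map_sub, map_mul _ (X ^ (2 * N) - C α), AdjoinRoot.mk_self, zero_mul, sub_zero]
  exact map_dvd _ (Dvd.intro _ rfl)

/-- For `N ≤ ℓ ≤ 2 N`, every codeword is `u v f` for a polynomial `f` over the field that is
divisible by `(x² - a) ^ (ℓ - N)`. -/
theorem exists_eq_u_mul_v_mul_coeff_of_mem_codeOfIdeal (hN : 0 < N)
    (hα : α = scalar α₁ + scalar α₃ * v F + scalar α₄ * (u F * v F))
    (hX : (X ^ 2 - C a : F[X]) ^ N = X ^ (2 * N) - C α₁) {ℓ : ℕ} (hℓ : N ≤ ℓ) (hℓ' : ℓ ≤ 2 * N)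
    {c : Fin (2 * N) → BaseRing F} (hc : c ∈ codeOfIdeal (typeBIdeal (2 * N) α a ℓ)) :
    ∃ f : F[X], f.natDegree < 2 * N ∧ (X ^ 2 - C a) ^ (ℓ - N) ∣ f ∧
      ∀ i, c i = u F * v F * scalarHom F (f.coeff i) := by
  have hnt : Nontrivial (BaseRing F) := ⟨_, _, u_mul_v_ne_zero F⟩
  obtain ⟨i, rfl⟩ := Nat.exists_eq_add_of_le hℓ
  rw [Nat.add_sub_cancel_left]
  set B : (BaseRing F)[X] := X ^ 2 - C (scalarHom F a) with hB
  set P : (BaseRing F)[X] := ∑ i : Fin (2 * N), C (c i) * X ^ (i : ℕ) with hP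
  have hmem : AdjoinRoot.mk (X ^ (2 * N) - C α) P ∈
      Ideal.span {AdjoinRoot.mk (X ^ (2 * N) - C α) (C (u F) * B ^ (N + i))} := hc
  rw [Ideal.mem_span_singleton] at hmem
  obtain ⟨z, hz⟩ := hmem
  obtain ⟨q, rfl⟩ := AdjoinRoot.mk_surjective z
  rw [← map_mul, AdjoinRoot.mk_eq_mk] at hz
  obtain ⟨q', hq'⟩ := exists_C_u_mul_v_mul_eq q
  have hmon : (X ^ (2 * N) - C α₁ : F[X]).Monic := monic_X_pow_sub_C _ (by omega)
  set f₀ : F[X] := C α₃ * (X ^ 2 - C a) ^ i * q' with hf₀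
  -- Multiplication by `u v` identifies `α` with `α₁`, so reduction modulo `X ^ (2 * N) - α` can be
  -- done over `F`.
  set f : F[X] := f₀ %ₘ (X ^ (2 * N) - C α₁) with hf
  have hdeg : f.natDegree < 2 * N := by
    have h1 : (X ^ (2 * N) - C α₁ : F[X]) ≠ 1 := by
      intro h
      have := congrArg natDegree h
      rw [natDegree_X_pow_sub_C, natDegree_one] at this
      omega
    simpa [natDegree_X_pow_sub_C] using natDegree_modByMonic_lt f₀ hmon h1
  have hdiv : f₀ = f + (X ^ (2 * N) - C α₁) * (f₀ /ₘ (X ^ (2 * N) - C α₁)) :=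
    (modByMonic_add_div f₀ _).symm
  refine ⟨f, hdeg, ?_, ?_⟩
  -- As `i ≤ N`, the modulus is itself divisible by `(X² - a) ^ i`, so divisibility survives the
  -- reduction.
  · have h1 : (X ^ 2 - C a) ^ i ∣ X ^ (2 * N) - C α₁ := by
      rw [← hX]
      exact pow_dvd_pow _ (by omega)
    have h2 : (X ^ 2 - C a) ^ i ∣ f₀ := ⟨C α₃ * q', by rw [hf₀]; ring⟩
    rw [hdiv] at h2
    exact (dvd_add_left (h1.mul_right _)).mp h2
  · have hword : ∑ i : Fin (2 * N), C (u F * v F * scalarHom F (f.coeff i)) * X ^ (i : ℕ) =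
        C (u F * v F) * f.map (scalarHom F) := by
      conv_rhs => rw [← sum_C_mul_X_pow_eq hdeg]
      simp [Polynomial.map_sum, Finset.mul_sum, mul_assoc]
    have hkey := C_u_mul_X_sq_sub_C_pow hα hX
    rw [← hB] at hkey
    have hf₀map : f₀.map (scalarHom F) =
        C (scalarHom F α₃) * B ^ i * q'.map (scalarHom F) := by
      simp [hf₀, hB]
    have hdivmap : C (scalarHom F α₃) * B ^ i * q'.map (scalarHom F) = f.map (scalarHom F) +
        (X ^ (2 * N) - C α₁ : F[X]).map (scalarHom F) *
          (f₀ /ₘ (X ^ (2 * N) - C α₁)).map (scalarHom F) := by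
      rw [← hf₀map, ← Polynomial.map_mul, ← Polynomial.map_add, ← hdiv]
    have hred := C_u_mul_v_mul_X_pow_sub_C hα (2 * N)
    have hdvd : X ^ (2 * N) - C α ∣ P - C (u F * v F) * f.map (scalarHom F) := by
      have h1 : X ^ (2 * N) - C α ∣ C (u F) * B ^ (N + i) * q -
          C (u F * v F) * f.map (scalarHom F) := by
        refine ⟨C (u F) * B ^ i * q +
          C (u F * v F) * (f₀ /ₘ (X ^ (2 * N) - C α₁)).map (scalarHom F), ?_⟩
        rw [pow_add]
        linear_combination (B ^ i * q) * hkey + (C (scalarHom F α₃) * B ^ i) * hq' +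
          C (u F * v F) * hdivmap +
          ((f₀ /ₘ (X ^ (2 * N) - C α₁)).map (scalarHom F)) * hred
      have := dvd_add hz h1
      rwa [sub_add_sub_cancel] at this
    -- Both representatives have degree below that of the monic modulus, so congruent means equal.
    have hzero : P - C (u F * v F) * f.map (scalarHom F) = 0 := by
      by_contra h0
      refine Monic.not_dvd_of_degree_lt (monic_X_pow_sub_C α (by omega)) h0 ?_ hdvd
      rw [degree_X_pow_sub_C (by omega), ← hword, hP]
      refine (degree_sub_le _ _).trans_lt (max_lt ?_ ?_)
      · exact degree_sum_fin_lt c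
      · exact degree_sum_fin_lt _
    intro j
    have := congrArg (fun Q => Q.coeff (j : ℕ)) (sub_eq_zero.mp hzero)
    simp only [coeff_C_mul, coeff_map] at this
    rw [← this]
    simp [hP, finsetSum_coeff, coeff_X_pow, Fin.val_inj]

open Classical in
theorem hammingNorm_u_mul_v_mul_coeff {n : ℕ} {f : F[X]} (hf : f.natDegree < n) :
    hammingNorm (fun i : Fin n => u F * v F * scalarHom F (f.coeff i)) = f.support.card := by
  rw [hammingNorm]
  refine Finset.card_bij (fun i _ => (i : ℕ)) ?_ ?_ ?_
  · intro i hi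
    rw [mem_support_iff]
    intro h
    simp [h] at hi
  · intro i _ j _ h
    exact Fin.ext h
  · intro k hk
    refine ⟨⟨k, (le_natDegree_of_mem_supp k hk).trans_lt hf⟩, ?_, rfl⟩
    simpa using u_mul_v_mul_scalarHom_ne_zero (mem_support_iff.mp hk)

theorem u_mul_v_mul_coeff_ne_zero {n : ℕ} {f : F[X]} (hf : f.natDegree < n) (hf0 : f ≠ 0) :
    (fun i : Fin n => u F * v F * scalarHom F (f.coeff i)) ≠ 0 := by
  classical
  rw [← hammingNorm_ne_zero_iff, hammingNorm_u_mul_v_mul_coeff hf]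
  simpa using hf0

end typeB

/-! ### The root `α₀` and the final computation. -/

theorem alphaZero_pow {F : Type*} [Field F] [Fintype F] {p m : ℕ} (hm : 1 ≤ m)
    (hF : Fintype.card F = p ^ m) (s : ℕ) (α₁ : F) : alphaZero p m s α₁ ^ p ^ s = α₁ := by
  -- The total Frobenius exponent is a multiple of `m`, hence acts trivially on `F`.
  have h : m - s % m + s = m * (s / m + 1) := by
    have h1 := Nat.div_add_mod s m
    have h2 := Nat.mod_lt s hm
    rw [mul_add, mul_one]
    omega
  rw [alphaZero, ← pow_mul, ← pow_add, h, pow_mul, ← hF]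
  exact FiniteField.pow_card_pow _ _

theorem theorem7 (p m s : ℕ) (hp : p.Prime) (hodd : Odd p) (hm : 1 ≤ m) (hs : 1 ≤ s)
    {F : Type*} [Field F] [Fintype F] (hF : Fintype.card F = p ^ m)
    (α₁ α₃ α₄ : F) (hα₁ : α₁ ≠ 0) (hα₃ : α₃ ≠ 0)
    (α : BaseRing F)
    (hα : α = BaseRing.scalar α₁ + BaseRing.scalar α₃ * BaseRing.v F
      + BaseRing.scalar α₄ * (BaseRing.u F * BaseRing.v F))
    (hsq : ¬ IsSquare α)
    (ℓ : ℕ) (hℓ : ℓ ≤ 2 * p ^ s - 1) :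
    (ℓ ≤ p ^ s →
      codeHammingDistance
        (codeOfIdeal (typeBIdeal (2 * p ^ s) α (alphaZero p m s α₁) ℓ)) = 1) ∧
    (∀ Γ γ : ℕ, 1 ≤ Γ → Γ ≤ p - 1 → γ ≤ s - 1 →
      2 * p ^ s - p ^ (s - γ) + (Γ - 1) * p ^ (s - γ - 1) + 1 ≤ ℓ →
      ℓ ≤ 2 * p ^ s - p ^ (s - γ) + Γ * p ^ (s - γ - 1) →
      codeHammingDistance
        (codeOfIdeal (typeBIdeal (2 * p ^ s) α (alphaZero p m s α₁) ℓ)) = (Γ + 1) * p ^ γ) := by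
  have hfact : Fact p.Prime := ⟨hp⟩
  have hchar : CharP F p := charP_of_card_eq_prime_pow hF
  have hpow := alphaZero_pow hm hF s α₁
  set a := alphaZero p m s α₁ with ha_def
  have ha : a ≠ 0 := by
    rw [ha_def, alphaZero]
    exact pow_ne_zero _ hα₁
  have hN : 0 < p ^ s := pow_pos hp.pos s
  have hX : (Polynomial.X ^ 2 - Polynomial.C a : Polynomial F) ^ p ^ s =
      Polynomial.X ^ (2 * p ^ s) - Polynomial.C α₁ := by
    rw [sub_pow_char_pow, ← pow_mul, ← Polynomial.C_pow, hpow]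
  classical
  refine ⟨fun hle => ?_, fun Γ γ hΓ hΓp hγ hlo hhi => ?_⟩
  · have h1 : (1 : Polynomial F).natDegree < 2 * p ^ s := by
      rw [Polynomial.natDegree_one]
      omega
    refine codeHammingDistance_eq (zero_mem_codeOfIdeal _) (sub_mem_codeOfIdeal _) ?_
      (u_mul_v_mul_coeff_mem_codeOfIdeal hα₃ hα hX h1 ?_)
      (u_mul_v_mul_coeff_ne_zero h1 one_ne_zero) ?_
    · intro c _ hc0
      rw [Nat.one_le_iff_ne_zero, hammingNorm_ne_zero_iff]
      exact hc0
    · rw [Nat.sub_eq_zero_of_le hle, pow_zero]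
    · refine (hammingNorm_u_mul_v_mul_coeff h1).le.trans_eq ?_
      rw [← Polynomial.C_1, Polynomial.support_C one_ne_zero, Finset.card_singleton]
  · obtain ⟨k, hk⟩ : ∃ k, s = γ + 1 + k := ⟨s - (γ + 1), by omega⟩
    have hs1 : s - γ = k + 1 := by omega
    have hs2 : s - γ - 1 = k := by omega
    rw [hs1, Nat.add_sub_cancel] at hlo hhi
    have hγ1 : 1 ≤ p ^ γ := Nat.one_le_pow _ _ hp.pos
    -- Rewrites `p ^ s - p ^ (s - γ)` as `p ^ k * (p * (p ^ γ - 1))`, matching the range of `ℓ - p ^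
    -- s` to the digit pattern.
    have hsplit : p ^ s = p ^ k * (p * (p ^ γ - 1)) + p ^ (k + 1) := by
      obtain ⟨e, he⟩ := Nat.exists_eq_add_of_le hγ1
      rw [hk, pow_add, pow_add, he, Nat.add_sub_cancel_left]
      ring
    have hΓk : Γ * p ^ k < p ^ (k + 1) := by
      rw [pow_succ']
      exact Nat.mul_lt_mul_of_pos_right (by have := hp.pos; omega) (pow_pos hp.pos k)
    have hlow : p ^ k * (p * (p ^ γ - 1) + (Γ - 1)) < ℓ - p ^ s := by
      rw [mul_add, mul_comm (p ^ k) (Γ - 1)]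
      omega
    have hhigh : ℓ - p ^ s ≤ p ^ k * (p * (p ^ γ - 1) + Γ) := by
      rw [mul_add, mul_comm (p ^ k) Γ]
      omega
    have hlt : p ^ k * (p * (p ^ γ - 1) + Γ) < p ^ s := by
      rw [mul_add, mul_comm (p ^ k) Γ]
      omega
    have hdeg : ((Polynomial.X ^ 2 - Polynomial.C a : Polynomial F) ^
        (p ^ k * (p * (p ^ γ - 1) + Γ))).natDegree < 2 * p ^ s := by
      rw [Polynomial.natDegree_pow, Polynomial.natDegree_X_pow_sub_C]
      omega
    refine codeHammingDistance_eq (zero_mem_codeOfIdeal _) (sub_mem_codeOfIdeal _) ?_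
      (u_mul_v_mul_coeff_mem_codeOfIdeal hα₃ hα hX hdeg (pow_dvd_pow _ hhigh))
      (u_mul_v_mul_coeff_ne_zero hdeg
        (pow_ne_zero _ (Polynomial.X_pow_sub_C_ne_zero two_pos a))) ?_
    · intro c hc hc0
      obtain ⟨f, hfdeg, hfdvd, hcf⟩ :=
        exists_eq_u_mul_v_mul_coeff_of_mem_codeOfIdeal hN hα hX (by omega) (by omega) hc
      obtain rfl : c = _ := funext hcf
      have hf0 : f ≠ 0 := by
        rintro rfl
        apply hc0
        funext i
        simp
      refine le_of_le_of_eq ?_ (hammingNorm_u_mul_v_mul_coeff hfdeg).symm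
      rw [hk] at hfdeg
      exact Polynomial.le_card_support_of_X_sq_sub_C_pow_dvd ha hΓ hΓp hlow hf0 hfdeg hfdvd
    · refine (hammingNorm_u_mul_v_mul_coeff hdeg).le.trans ?_
      exact Polynomial.card_support_X_sq_sub_C_pow_le a Γ γ k
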